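/- For a finite group $G$, let $h(G)=\dfrac{\prod_{K}|K|}{\prod_{\chi}\chi(1)}$, where $K$ runs over the conjugacy classes of $G$ and $\chi$ over the irreducible complex characters of $G$, and let $G'$ be the commutator subgroup of $G$. For every integer $n\ge 2$, the generalized quaternion group \[ Q_{4n}=\langle \sigma,\tau \mid \sigma^{2n}=1,\ \sigma^n=\tau^2,\ \tau^{-1}\sigma\tau=\sigma^{-1}\rangle \] of order $4n$ satisfies $h(Q_{4n})=n^2=|Q_{4n}'|^2$. -/

import Mathlib

/-- `Irr(G)`: the set of characters of the irreducible finite-dimensional complex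
representations of `G`, as functions `G → ℂ` (so isomorphic representations count once). -/
def irrChars (G : Type*) [Group G] : Set (G → ℂ) :=
  {χ | ∃ (V : Type) (_ : AddCommGroup V) (_ : Module ℂ V) (_ : FiniteDimensional ℂ V)
    (ρ : Representation ℂ G V), ρ.IsIrreducible ∧ ρ.character = χ}

/-- First orthogonality relation for the elements of `Irr(G)`. -/
theorem irrChars_orthonormal (G : Type*) [Group G] [Fintype G] {χ ψ : G → ℂ}
    (hχ : χ ∈ irrChars G) (hψ : ψ ∈ irrChars G) :
    (χ = ψ → (Nat.card G : ℂ)⁻¹ * ∑ g : G, χ g * ψ g⁻¹ = 1) ∧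
    (χ ≠ ψ → (Nat.card G : ℂ)⁻¹ * ∑ g : G, χ g * ψ g⁻¹ = 0) := by
  obtain ⟨V, _, _, _, ρ, hρ, rfl⟩ := hχ
  obtain ⟨W, _, _, _, σ, hσ, rfl⟩ := hψ
  have : Invertible (Nat.card G : ℂ) :=
    invertibleOfNonzero (Nat.cast_ne_zero.mpr Nat.card_pos.ne')
  refine ⟨fun h => ?_, fun h => ?_⟩
  · rw [← h, Representation.char_orthonormal ρ ρ, if_pos ⟨Representation.Equiv.refl ρ⟩]
  · rw [Representation.char_orthonormal ρ σ, if_neg]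
    rintro ⟨e⟩
    exact h (Representation.char_iso e).symm

/-- A finite group has only finitely many irreducible characters. -/
theorem irrChars_finite (G : Type*) [Group G] [Finite G] : (irrChars G).Finite := by
  classical
  have := Fintype.ofFinite G
  have hli : LinearIndependent ℂ (fun χ : irrChars G => (χ : G → ℂ)) := by
    rw [linearIndependent_iff']
    intro s c hc χ hχ
    have h1 : ∑ ψ ∈ s, c ψ * ((Nat.card G : ℂ)⁻¹ * ∑ g : G, ψ.1 g * χ.1 g⁻¹) = 0 := by
      have h2 : ∀ g : G, ∑ ψ ∈ s, c ψ * ψ.1 g = 0 := fun g => by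
        simpa using congrFun hc g
      calc _ = (Nat.card G : ℂ)⁻¹ * ∑ g : G, (∑ ψ ∈ s, c ψ * ψ.1 g) * χ.1 g⁻¹ := by
            simp only [Finset.mul_sum, Finset.sum_mul]
            rw [Finset.sum_comm]
            exact Finset.sum_congr rfl fun _ _ => Finset.sum_congr rfl fun _ _ => by ring
        _ = 0 := by simp [h2]
    rw [Finset.sum_eq_single_of_mem χ hχ] at h1
    · rwa [(irrChars_orthonormal G χ.2 χ.2).1 rfl, mul_one] at h1
    · intro ψ _ hne
      rw [(irrChars_orthonormal G ψ.2 χ.2).2 fun h => hne (Subtype.ext h), mul_zero]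
  exact hli.setFinite

/-- Harada's number `h(G) = ∏ |K| / ∏ χ(1)` of a finite group `G`, with `K` running over the
conjugacy classes and `χ` over the irreducible complex characters; a rational number, here
regarded as an element of `ℂ`, where the values `χ(1)` live. -/
noncomputable def haradaNumber (G : Type*) [Group G] [Finite G] : ℂ :=
  (∏ᶠ K : ConjClasses G, (Nat.card K.carrier : ℂ)) /
    ∏ χ ∈ (irrChars_finite G).toFinset, χ 1

/-! Both products contain the factor `2 ^ (n - 1)`, and the quotient leaves `n ^ 2`. Let `A` be the
cyclic subgroup of index 2 generated by `a 1`. An irreducible representation contains an eigenvector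
of `A`, so it is a quotient of a representation induced from a character `ψ_k` of `A`. If `k ≠ -k`,
the induced representation is irreducible of degree 2; if `k = -k`, then `A` acts by scalars and the
quotient has degree 1 (`character_one_eq_one_or_eq_character_rep`). The pairs `{k, -k}` with `0 < k
< n` give the `n - 1` factors 2. The classes are `{a i, a (-i)}`, of size 2 for `0 < i < n` and of
size 1 for `i = 0, n`, and the `xa i` split by parity of `i` into two classes of size `n`. The
commutator subgroup is generated by `a 2`, of order `n`. -/

namespace Representation

theorem IsIrreducible.eq_top_of_mem {k G V : Type*} [Field k] [Group G] [AddCommGroup V]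
    [Module k V] {ρ : Representation k G V} (hρ : ρ.IsIrreducible) (p : Submodule k V)
    (hp : ∀ g, ∀ v ∈ p, ρ g v ∈ p) {v : V} (hv : v ∈ p) (hv0 : v ≠ 0) : p = ⊤ := by
  rcases eq_bot_or_eq_top (⟨p, hp⟩ : Subrepresentation ρ) with h | h
  · have : p = ⊥ := congrArg Subrepresentation.toSubmodule h
    exact absurd ((Submodule.mem_bot k).1 (this ▸ hv)) hv0
  · exact congrArg Subrepresentation.toSubmodule h

theorem IsIrreducible.nontrivial {k G V : Type*} [Field k] [Group G] [AddCommGroup V]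
    [Module k V] {ρ : Representation k G V} (hρ : ρ.IsIrreducible) : Nontrivial V := by
  by_contra h
  rw [not_nontrivial_iff_subsingleton] at h
  exact bot_ne_top (α := Subrepresentation ρ)
    (Subrepresentation.toSubmodule_injective (Subsingleton.elim _ _))

end Representation

/-! ### Irreducible characters -/

namespace QuaternionGroup

open Matrix

variable {n : ℕ}

theorem neg_natCast_self (n : ℕ) : -(n : ZMod (2 * n)) = n := by
  rw [neg_eq_iff_add_eq_zero, ← two_mul]
  exact_mod_cast ZMod.natCast_self (2 * n)

/-- The representation of `QuaternionGroup n` induced from the character `ψ` of its cyclic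
subgroup generated by `a 1`. -/
noncomputable def inducedRep (ψ : AddChar (ZMod (2 * n)) ℂ) :
    Representation ℂ (QuaternionGroup n) (Fin 2 → ℂ) :=
  (Matrix.toLinAlgEquiv' : Matrix (Fin 2) (Fin 2) ℂ ≃ₐ[ℂ] _).toMonoidHom.comp
    { toFun
        | a i => !![ψ i, 0; 0, ψ (-i)]
        | xa i => !![0, ψ (n - i); ψ i, 0]
      map_one' := by
        rw [one_def]
        simp [Matrix.one_fin_two]
      map_mul' := by
        have h := neg_natCast_self n
        rintro (i | i) (j | j) <;>
          simp only [a_mul_a, a_mul_xa, xa_mul_a, xa_mul_xa, Matrix.mul_fin_two, mul_zero,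
            zero_mul, add_zero, zero_add, ← AddChar.map_add_eq_mul] <;>
          congr! 4 <;> grind }

theorem inducedRep_a (ψ : AddChar (ZMod (2 * n)) ℂ) (i : ZMod (2 * n)) (v : Fin 2 → ℂ) :
    inducedRep ψ (a i) v = ![ψ i * v 0, ψ (-i) * v 1] := by
  change Matrix.toLin' !![ψ i, 0; 0, ψ (-i)] v = _
  simp [Matrix.toLin'_apply, Matrix.cons_mulVec, dotProduct]

theorem inducedRep_xa (ψ : AddChar (ZMod (2 * n)) ℂ) (i : ZMod (2 * n)) (v : Fin 2 → ℂ) :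
    inducedRep ψ (xa i) v = ![ψ (n - i) * v 1, ψ i * v 0] := by
  change Matrix.toLin' !![0, ψ (n - i); ψ i, 0] v = _
  simp [Matrix.toLin'_apply, Matrix.cons_mulVec, dotProduct]

theorem character_inducedRep_a (ψ : AddChar (ZMod (2 * n)) ℂ) (i : ZMod (2 * n)) :
    (inducedRep ψ).character (a i) = ψ i + ψ (-i) := by
  change LinearMap.trace ℂ _ (Matrix.toLin' !![ψ i, 0; 0, ψ (-i)]) = _
  rw [Matrix.trace_toLin'_eq, Matrix.trace_fin_two_of]

theorem character_inducedRep_xa (ψ : AddChar (ZMod (2 * n)) ℂ) (i : ZMod (2 * n)) :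
    (inducedRep ψ).character (xa i) = 0 := by
  change LinearMap.trace ℂ _ (Matrix.toLin' !![0, ψ (n - i); ψ i, 0]) = _
  rw [Matrix.trace_toLin'_eq, Matrix.trace_fin_two_of, add_zero]

/-- The eigenvalues of `a 1` on the two coordinate axes differ, so a nonzero invariant subspace
contains an axis, and `xa 0` interchanges the axes. -/
theorem isIrreducible_inducedRep {ψ : AddChar (ZMod (2 * n)) ℂ} (hψ : ψ 1 ≠ ψ (-1)) :
    (inducedRep ψ).IsIrreducible := by
  have hsub : ψ 1 - ψ (-1) ≠ 0 := sub_ne_zero.2 hψ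
  have hne : ∀ i, ψ i ≠ 0 := fun i => (ψ.val_isUnit i).ne_zero
  have key : ∀ (U : Subrepresentation (inducedRep ψ)) (v : Fin 2 → ℂ), v ∈ U.toSubmodule →
      v ≠ 0 → U = ⊤ := by
    intro U v hv hv0
    have hdiag : ∀ u ∈ U.toSubmodule, u 0 ≠ 0 → (![1, 0] : Fin 2 → ℂ) ∈ U.toSubmodule := by
      intro u hu hu0
      -- Subtracting `ψ (-1)` from the action of `a 1` kills the second coordinate.
      have h1 := U.toSubmodule.sub_mem (U.apply_mem_toSubmodule (a 1) hu)
        (U.toSubmodule.smul_mem (ψ (-1)) hu)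
      convert U.toSubmodule.smul_mem ((ψ 1 - ψ (-1)) * u 0)⁻¹ h1 using 1
      rw [inducedRep_a]
      ext i
      fin_cases i
      · change 1 = ((ψ 1 - ψ (-1)) * u 0)⁻¹ * (ψ 1 * u 0 - ψ (-1) * u 0)
        rw [← sub_mul, inv_mul_cancel₀ (mul_ne_zero hsub hu0)]
      · change 0 = ((ψ 1 - ψ (-1)) * u 0)⁻¹ * (ψ (-1) * u 1 - ψ (-1) * u 1)
        rw [sub_self, mul_zero]
    have h0 : (![1, 0] : Fin 2 → ℂ) ∈ U.toSubmodule := by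
      by_cases hv1 : v 0 = 0
      · refine hdiag _ (U.apply_mem_toSubmodule (xa 0) hv) ?_
        rw [inducedRep_xa]
        have : v 1 ≠ 0 := fun h => hv0 (by ext i; fin_cases i <;> assumption)
        simpa using ⟨hne _, this⟩
      · exact hdiag v hv hv1
    have h1 : (![0, 1] : Fin 2 → ℂ) ∈ U.toSubmodule := by
      have := U.apply_mem_toSubmodule (xa 0) h0
      rw [inducedRep_xa] at this
      simpa using this
    apply Subrepresentation.toSubmodule_injective
    refine eq_top_iff.2 fun w _ => ?_
    convert U.toSubmodule.add_mem (U.toSubmodule.smul_mem (w 0) h0)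
      (U.toSubmodule.smul_mem (w 1) h1) using 1
    ext i
    fin_cases i <;> simp
  refine { exists_pair_ne := ⟨⊥, ⊤, fun h => ?_⟩, eq_bot_or_eq_top := fun U => ?_ }
  · have h' : (⊥ : Submodule ℂ (Fin 2 → ℂ)) = ⊤ := congrArg Subrepresentation.toSubmodule h
    exact bot_ne_top h'
  · by_cases h : U.toSubmodule = ⊥
    · exact Or.inl (Subrepresentation.toSubmodule_injective h)
    · obtain ⟨v, hv, hv0⟩ := Submodule.exists_mem_ne_zero_of_ne_bot h
      exact Or.inr (key U v hv hv0)

/-- Frobenius reciprocity for `inducedRep`: an eigenvector of the cyclic subgroup gives an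
intertwining map. -/
theorem exists_intertwiningMap_inducedRep {V : Type*} [AddCommGroup V] [Module ℂ V]
    {ρ : Representation ℂ (QuaternionGroup n) V} {ψ : AddChar (ZMod (2 * n)) ℂ} {v : V}
    (hv : ∀ i, ρ (a i) v = ψ i • v) :
    ∃ f : (inducedRep ψ).IntertwiningMap ρ, f ![1, 0] = v := by
  have hw : ∀ g h, ρ g (ρ h v) = ρ (g * h) v := fun g h => by rw [map_mul]; rfl
  have hx : ∀ i, ρ (xa i) v = ψ i • ρ (xa 0) v := fun i => by
    rw [← map_smul, ← hv, hw, xa_mul_a, zero_add]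
  let f : (Fin 2 → ℂ) →ₗ[ℂ] V :=
    (LinearMap.proj 0).smulRight v + (LinearMap.proj 1).smulRight (ρ (xa 0) v)
  have hf : ∀ u, f u = u 0 • v + u 1 • ρ (xa 0) v := fun u => rfl
  refine ⟨f.intertwiningMap_of_isIntertwiningMap _ _ ?_, ?_⟩
  · rintro (i | i) u
    · rw [inducedRep_a, hf, hf, map_add, map_smul, map_smul, hv, hw, a_mul_xa, hx (0 - i)]
      simp [smul_smul, mul_comm]
    · rw [inducedRep_xa, hf, hf, map_add, map_smul, map_smul, hw, xa_mul_xa, hv, hx i]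
      simp [smul_smul, mul_comm, add_comm]
  · simp [hf]

/-- The group is generated by the `a i` and `xa 0`, so an eigenvector of `xa 0` spans an invariant
line. -/
theorem finrank_eq_one_of_forall_smul {V : Type*} [AddCommGroup V] [Module ℂ V]
    [FiniteDimensional ℂ V] {ρ : Representation ℂ (QuaternionGroup n) V} (hρ : ρ.IsIrreducible)
    {c : ZMod (2 * n) → ℂ} (h : ∀ i v, ρ (a i) v = c i • v) : Module.finrank ℂ V = 1 := by
  have := hρ.nontrivial
  obtain ⟨z, hz⟩ := Module.End.exists_eigenvalue (ρ (xa 0))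
  obtain ⟨u, hu⟩ := hz.exists_hasEigenvector
  have htop := hρ.eq_top_of_mem (Submodule.span ℂ {u}) (fun g v hv => by
    obtain ⟨r, rfl⟩ := Submodule.mem_span_singleton.1 hv
    rcases g with i | i
    · rw [h]
      exact Submodule.smul_mem _ _ hv
    · have hx : (xa i : QuaternionGroup n) = xa 0 * a i := by simp
      rw [hx, map_mul, Module.End.mul_apply, h, map_smul, map_smul, hu.apply_eq_smul]
      exact Submodule.smul_mem _ _ (Submodule.smul_mem _ _ (Submodule.smul_mem _ _
        (Submodule.mem_span_singleton_self u)))) (Submodule.mem_span_singleton_self u) hu.2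
  rw [← finrank_top ℂ V, ← htop, finrank_span_singleton hu.2]

theorem natCast_ne_neg_natCast {i : ℕ} (hi : i ∈ Finset.Ioo 0 n) :
    (i : ZMod (2 * n)) ≠ -(i : ZMod (2 * n)) := by
  rw [Finset.mem_Ioo] at hi
  rw [Ne, eq_neg_iff_add_eq_zero]
  intro h
  have := Nat.le_of_dvd (by omega) ((ZMod.natCast_eq_zero_iff (i + i) (2 * n)).1 (by simpa using h))
  omega

/-- The two-dimensional representation of `QuaternionGroup n` in which `a 1` has the eigenvalues
`exp (± 2πik / 2n)`. -/
noncomputable def rep [NeZero n] (k : ZMod (2 * n)) :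
    Representation ℂ (QuaternionGroup n) (Fin 2 → ℂ) :=
  inducedRep (ZMod.stdAddChar.mulShift k)

variable [NeZero n]

theorem isIrreducible_rep {k : ZMod (2 * n)} (hk : k ≠ -k) : (rep k).IsIrreducible :=
  isIrreducible_inducedRep fun h => hk (ZMod.injective_stdAddChar (by simpa using h))

theorem character_rep_neg (k : ZMod (2 * n)) : (rep (-k)).character = (rep k).character := by
  ext (i | i)
  · simp [rep, character_inducedRep_a, add_comm]
  · simp [rep, character_inducedRep_xa]

theorem character_rep_one (k : ZMod (2 * n)) : (rep k).character 1 = 2 := by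
  simp [Representation.char_one]

/-- The value at `a 1` is the sum of two numbers with product 1, hence determines them up to order.
-/
theorem eq_or_eq_neg_of_character_rep_eq {k l : ZMod (2 * n)}
    (h : (rep k).character = (rep l).character) : k = l ∨ k = -l := by
  have h1 := congrFun h (a 1)
  simp only [rep, character_inducedRep_a, AddChar.mulShift_apply, mul_one, mul_neg] at h1
  have hk : ZMod.stdAddChar k * ZMod.stdAddChar (-k) = (1 : ℂ) := by
    rw [← AddChar.map_add_eq_mul, add_neg_cancel, AddChar.map_zero_eq_one]
  have hl : ZMod.stdAddChar l * ZMod.stdAddChar (-l) = (1 : ℂ) := by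
    rw [← AddChar.map_add_eq_mul, add_neg_cancel, AddChar.map_zero_eq_one]
  have h2 : ((ZMod.stdAddChar k : ℂ) - ZMod.stdAddChar l) *
      (ZMod.stdAddChar k - ZMod.stdAddChar (-l)) = 0 := by
    linear_combination (ZMod.stdAddChar k : ℂ) * h1 - hk + hl
  rcases mul_eq_zero.1 h2 with h3 | h3
  · exact Or.inl (ZMod.injective_stdAddChar (sub_eq_zero.1 h3))
  · exact Or.inr (ZMod.injective_stdAddChar (sub_eq_zero.1 h3))

theorem exists_stdAddChar_eq_of_pow_eq_one {N : ℕ} [NeZero N] {z : ℂ} (hz : z ^ N = 1) :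
    ∃ k : ZMod N, ZMod.stdAddChar k = z := by
  obtain ⟨i, -, hi⟩ := (Complex.isPrimitiveRoot_exp N (NeZero.ne N)).eq_pow_of_pow_eq_one hz
  refine ⟨((i : ℤ) : ZMod N), ?_⟩
  rw [ZMod.stdAddChar_coe, ← hi, ← Complex.exp_nat_mul]
  congr 1
  push_cast
  ring

theorem exists_eigenvector {V : Type*} [AddCommGroup V] [Module ℂ V] [FiniteDimensional ℂ V]
    [Nontrivial V] (ρ : Representation ℂ (QuaternionGroup n) V) :
    ∃ (k : ZMod (2 * n)) (v : V), v ≠ 0 ∧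
      ∀ i, ρ (a i) v = (ZMod.stdAddChar.mulShift k : AddChar (ZMod (2 * n)) ℂ) i • v := by
  obtain ⟨z, hz⟩ := Module.End.exists_eigenvalue (ρ (a 1))
  obtain ⟨v, hv⟩ := hz.exists_hasEigenvector
  have hpow : ∀ m : ℕ, ρ (a m) v = z ^ m • v := fun m => by
    rw [← a_one_pow, map_pow, hv.pow_apply]
  have hz1 : z ^ (2 * n) = 1 := by
    have h := hpow (2 * n)
    rw [ZMod.natCast_self, a_zero, map_one, Module.End.one_apply] at h
    have h' : (z ^ (2 * n) - 1) • v = 0 := by rw [sub_smul, ← h, one_smul, sub_self]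
    exact sub_eq_zero.1 ((smul_eq_zero.1 h').resolve_right hv.2)
  obtain ⟨k, rfl⟩ := exists_stdAddChar_eq_of_pow_eq_one hz1
  refine ⟨k, v, hv.2, fun i => ?_⟩
  have h := hpow i.val
  rw [ZMod.natCast_zmod_val] at h
  rw [h, ← AddChar.map_nsmul_eq_pow, AddChar.mulShift_apply, nsmul_eq_mul,
    ZMod.natCast_zmod_val, mul_comm k i]

theorem character_one_eq_one_or_eq_character_rep {V : Type*} [AddCommGroup V] [Module ℂ V]
    [FiniteDimensional ℂ V] {ρ : Representation ℂ (QuaternionGroup n) V}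
    (hρ : ρ.IsIrreducible) :
    ρ.character 1 = 1 ∨ ∃ k : ZMod (2 * n), k ≠ -k ∧ ρ.character = (rep k).character := by
  have := hρ.nontrivial
  obtain ⟨k, v, hv0, hv⟩ := exists_eigenvector ρ
  obtain ⟨f, hf⟩ := exists_intertwiningMap_inducedRep hv
  have hf0 : f ≠ 0 := by
    rintro rfl
    exact hv0 hf.symm
  by_cases hk : k = -k
  · left
    have hsurj := (Representation.IsIrreducible.surjective_or_eq_zero f).resolve_right hf0
    rw [Representation.char_one, finrank_eq_one_of_forall_smul hρ
      (c := fun i => ZMod.stdAddChar (k * i)), Nat.cast_one]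
    intro i w
    obtain ⟨u, rfl⟩ := hsurj w
    rw [← f.isIntertwining, ← map_smul, inducedRep_a]
    congr 1
    -- When `k = -k`, both diagonal entries of `a i` agree; this scalar action passes to `V` along
    -- the surjection `f`.
    have hki : k * -i = k * i := by rw [mul_neg, ← neg_mul, ← hk]
    ext j
    fin_cases j <;> simp [-mul_neg, hki]
  · right
    have : (inducedRep (ZMod.stdAddChar.mulShift k)).IsIrreducible := isIrreducible_rep hk
    exact ⟨k, hk, (Representation.char_iso (f.ofBijective
      ((Representation.IsIrreducible.bijective_or_eq_zero f).resolve_right hf0))).symm⟩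

theorem exists_natCast_eq_or_eq_neg (k : ZMod (2 * n)) :
    ∃ i ≤ n, k = (i : ZMod (2 * n)) ∨ k = -(i : ZMod (2 * n)) := by
  have hk := ZMod.natCast_zmod_val k
  have hlt := ZMod.val_lt k
  by_cases h : k.val ≤ n
  · exact ⟨k.val, h, Or.inl hk.symm⟩
  · refine ⟨2 * n - k.val, by omega, Or.inr ?_⟩
    rw [Nat.cast_sub hlt.le, ZMod.natCast_self, hk]
    simp

theorem natCast_injOn_of_eq_or_eq_neg {i j : ℕ} (hi : i ≤ n) (hj : j ≤ n)
    (h : (i : ZMod (2 * n)) = j ∨ (i : ZMod (2 * n)) = -(j : ZMod (2 * n))) : i = j := by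
  have hn := NeZero.pos n
  rcases h with h | h
  · rw [ZMod.natCast_eq_natCast_iff'] at h
    rwa [Nat.mod_eq_of_lt (by omega), Nat.mod_eq_of_lt (by omega)] at h
  · rw [eq_neg_iff_add_eq_zero] at h
    obtain ⟨c, hc⟩ := (ZMod.natCast_eq_zero_iff (i + j) (2 * n)).1 (by simpa using h)
    -- As `i + j ≤ 2 * n`, a multiple of `2 * n` forces `i = j = 0` or `i = j = n`.
    rcases Nat.lt_or_ge c 1 with h0 | h0
    · obtain rfl : c = 0 := by omega
      omega
    · have := Nat.le_mul_of_pos_right (2 * n) h0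
      omega

/-- The degree-one characters contribute factors 1, so they need not be counted. -/
theorem prod_irrChars_one :
    ∏ χ ∈ (irrChars_finite (QuaternionGroup n)).toFinset, χ 1 = 2 ^ (n - 1) := by
  classical
  let χ : ℕ → QuaternionGroup n → ℂ := fun i => (rep (i : ZMod (2 * n))).character
  have hinj : Set.InjOn χ (Finset.Ioo 0 n) := fun i hi j hj h => by
    simp only [Finset.coe_Ioo, Set.mem_Ioo] at hi hj
    exact natCast_injOn_of_eq_or_eq_neg hi.2.le hj.2.le (eq_or_eq_neg_of_character_rep_eq h)
  have hsub : (Finset.Ioo 0 n).image χ ⊆ (irrChars_finite (QuaternionGroup n)).toFinset := by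
    intro ψ hψ
    obtain ⟨i, hi, rfl⟩ := Finset.mem_image.1 hψ
    rw [Set.Finite.mem_toFinset]
    exact ⟨_, _, _, inferInstance, _, isIrreducible_rep (natCast_ne_neg_natCast hi), rfl⟩
  rw [← Finset.prod_subset hsub, Finset.prod_image hinj,
    Finset.prod_congr rfl fun i _ => character_rep_one _]
  · simp
  · intro ψ hψ hψT
    obtain ⟨V, _, _, _, ρ, hρ, rfl⟩ := (Set.Finite.mem_toFinset _).1 hψ
    refine (character_one_eq_one_or_eq_character_rep hρ).resolve_right ?_
    rintro ⟨k, hk, hρk⟩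
    obtain ⟨i, hi, hki⟩ := exists_natCast_eq_or_eq_neg k
    have hik : ρ.character = χ i := by
      rcases hki with rfl | rfl
      · exact hρk
      · rw [hρk, character_rep_neg]
    refine hψT (Finset.mem_image.2 ⟨i, Finset.mem_Ioo.2 ⟨Nat.pos_of_ne_zero ?_,
      lt_of_le_of_ne hi ?_⟩, hik.symm⟩)
    · rintro rfl
      exact hk (by rcases hki with rfl | rfl <;> simp)
    · rintro rfl
      exact hk (by rcases hki with rfl | rfl <;> simp [neg_natCast_self])

end QuaternionGroup

/-! ### Conjugacy classes and the commutator subgroup -/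

namespace QuaternionGroup

variable {n : ℕ}

theorem isConj_a_iff (i : ZMod (2 * n)) (g : QuaternionGroup n) :
    IsConj (a i) g ↔ g = a i ∨ g = a (-i) := by
  rw [isConj_iff]
  constructor
  · rintro ⟨j | j, rfl⟩
    · left
      rw [mul_inv_eq_iff_eq_mul]
      simp [add_comm]
    · right
      rw [mul_inv_eq_iff_eq_mul]
      simp
  · rintro (rfl | rfl)
    · exact ⟨1, by simp⟩
    · exact ⟨xa 0, by rw [mul_inv_eq_iff_eq_mul]; simp⟩

/-- Conjugation by `a (-j)` shifts the index by `2 * j`, and conjugation by any `xa j` also shifts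
it by an even amount. -/
theorem isConj_xa_iff (i : ZMod (2 * n)) (g : QuaternionGroup n) :
    IsConj (xa i) g ↔ ∃ j, g = xa (i + 2 * j) := by
  rw [isConj_iff]
  constructor
  · rintro ⟨j | j, rfl⟩
    · refine ⟨-j, ?_⟩
      rw [mul_inv_eq_iff_eq_mul]
      simp
      ring
    · refine ⟨j - i, ?_⟩
      rw [mul_inv_eq_iff_eq_mul]
      simp
      ring
  · rintro ⟨j, rfl⟩
    refine ⟨a (-j), ?_⟩
    rw [mul_inv_eq_iff_eq_mul]
    simp
    ring

theorem two_mul_injOn {j k : ℕ} (hj : j < n) (hk : k < n)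
    (h : (2 * j : ZMod (2 * n)) = 2 * k) : j = k := by
  have h' : ((2 * j : ℕ) : ZMod (2 * n)) = (2 * k : ℕ) := by exact_mod_cast h
  rw [ZMod.natCast_eq_natCast_iff', Nat.mod_eq_of_lt (by omega), Nat.mod_eq_of_lt (by omega)] at h'
  omega

theorem carrier_a (i : ZMod (2 * n)) :
    (ConjClasses.mk (a i : QuaternionGroup n)).carrier = {a i, a (-i)} := by
  ext g
  rw [ConjClasses.mem_carrier_iff_mk_eq, eq_comm, ConjClasses.mk_eq_mk_iff_isConj, isConj_a_iff]
  rfl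

theorem card_carrier_a_of_ne_neg {i : ZMod (2 * n)} (hi : i ≠ -i) :
    Nat.card (ConjClasses.mk (a i : QuaternionGroup n)).carrier = 2 := by
  rw [carrier_a, Nat.card_coe_set_eq, Set.ncard_pair fun h => hi (a.inj h)]

theorem card_carrier_a_of_eq_neg {i : ZMod (2 * n)} (hi : i = -i) :
    Nat.card (ConjClasses.mk (a i : QuaternionGroup n)).carrier = 1 := by
  rw [carrier_a, ← hi, Set.pair_eq_singleton, Nat.card_coe_set_eq, Set.ncard_singleton]

theorem xa_zero_mk_ne :
    ConjClasses.mk (xa 0 : QuaternionGroup n) ≠ ConjClasses.mk (xa 1) := by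
  rw [Ne, ConjClasses.mk_eq_mk_iff_isConj, isConj_xa_iff]
  rintro ⟨j, hj⟩
  -- Parity is well defined on `ZMod (2 * n)`: reduce modulo 2.
  have h := congrArg (ZMod.castHom (Dvd.intro n rfl : 2 ∣ 2 * n) (ZMod 2)) (xa.inj hj)
  have h2 : (2 : ZMod 2) = 0 := rfl
  rw [map_one, zero_add, map_mul, map_ofNat, h2, zero_mul] at h
  exact one_ne_zero h

variable [NeZero n]

theorem exists_two_mul_eq (j : ZMod (2 * n)) :
    ∃ k < n, (2 * j : ZMod (2 * n)) = 2 * (k : ZMod (2 * n)) := by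
  refine ⟨j.val % n, Nat.mod_lt _ (NeZero.pos n), ?_⟩
  have h : ((2 * j.val : ℕ) : ZMod (2 * n)) = (2 * (j.val % n) : ℕ) := by
    rw [← Nat.mul_mod_mul_left, ZMod.natCast_mod]
  simpa using h

theorem card_carrier_xa (i : ZMod (2 * n)) :
    Nat.card (ConjClasses.mk (xa i : QuaternionGroup n)).carrier = n := by
  have h : (ConjClasses.mk (xa i : QuaternionGroup n)).carrier =
      (fun j : ℕ => xa (i + 2 * (j : ZMod (2 * n)))) '' (Finset.range n : Set ℕ) := by
    ext g
    rw [ConjClasses.mem_carrier_iff_mk_eq, eq_comm, ConjClasses.mk_eq_mk_iff_isConj,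
      isConj_xa_iff]
    constructor
    · rintro ⟨j, rfl⟩
      obtain ⟨k, hk, hjk⟩ := exists_two_mul_eq j
      exact ⟨k, by simpa using hk, by simp only [hjk]⟩
    · rintro ⟨k, -, rfl⟩
      exact ⟨k, rfl⟩
  rw [h, Nat.card_coe_set_eq, Set.InjOn.ncard_image, Set.ncard_coe_finset, Finset.card_range]
  intro j hj k hk hjk
  exact two_mul_injOn (by simpa using hj) (by simpa using hk)
    (add_left_cancel (xa.inj hjk))

theorem xa_mk_eq_or (i : ZMod (2 * n)) :
    ConjClasses.mk (xa i) = ConjClasses.mk (xa 0 : QuaternionGroup n) ∨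
      ConjClasses.mk (xa i) = ConjClasses.mk (xa 1 : QuaternionGroup n) := by
  have hi := ZMod.natCast_zmod_val i
  rw [eq_comm, ConjClasses.mk_eq_mk_iff_isConj, isConj_xa_iff, eq_comm,
    ConjClasses.mk_eq_mk_iff_isConj, isConj_xa_iff]
  rcases Nat.even_or_odd' i.val with ⟨m, hm | hm⟩
  · refine Or.inl ⟨m, ?_⟩
    rw [← hi, hm]
    simp
  · refine Or.inr ⟨m, ?_⟩
    rw [← hi, hm]
    push_cast
    rw [add_comm]

theorem prod_card_conjClasses :
    ∏ᶠ K : ConjClasses (QuaternionGroup n), (Nat.card K.carrier : ℂ) =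
      2 ^ (n - 1) * (n : ℂ) ^ 2 := by
  classical
  let c : ℕ → ConjClasses (QuaternionGroup n) := fun i => ConjClasses.mk (a (i : ZMod (2 * n)))
  have hinj : Set.InjOn c (Finset.range (n + 1)) := by
    intro i hi j hj h
    simp only [Finset.coe_range, Set.mem_Iio] at hi hj
    rw [eq_comm, ConjClasses.mk_eq_mk_iff_isConj, isConj_a_iff, a.injEq, a.injEq] at h
    exact natCast_injOn_of_eq_or_eq_neg (by omega) (by omega) h
  have hax : ∀ i j, ConjClasses.mk (xa j : QuaternionGroup n) ≠ c i := by
    intro i j h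
    rw [eq_comm, ConjClasses.mk_eq_mk_iff_isConj, isConj_a_iff] at h
    simp at h
  have huniv : ∀ K : ConjClasses (QuaternionGroup n),
      K ∈ insert (ConjClasses.mk (xa 0)) (insert (ConjClasses.mk (xa 1))
        ((Finset.range (n + 1)).image c)) := by
    intro K
    obtain ⟨i | i, rfl⟩ := ConjClasses.mk_surjective K
    · obtain ⟨j, hj, hij⟩ := exists_natCast_eq_or_eq_neg i
      refine Finset.mem_insert_of_mem (Finset.mem_insert_of_mem (Finset.mem_image.2
        ⟨j, Finset.mem_range.2 (by omega), ?_⟩))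
      rw [ConjClasses.mk_eq_mk_iff_isConj, isConj_a_iff, a.injEq, a.injEq]
      exact hij
    · rcases xa_mk_eq_or i with h | h <;> simp [h]
  -- The indices `0, ..., n` are split into the endpoints, which give central elements, and the `n -
  -- 1` interior ones.
  rw [finprod_eq_prod_of_mulSupport_subset _ (fun K _ => Finset.mem_coe.2 (huniv K)),
    Finset.prod_insert, Finset.prod_insert, Finset.prod_image hinj, card_carrier_xa,
    card_carrier_xa, Finset.prod_range_succ, ← Nat.Ico_zero_eq_range,
    ← Finset.Ioo_insert_left (NeZero.pos n), Finset.prod_insert Finset.left_notMem_Ioo,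
    card_carrier_a_of_eq_neg (i := ((0 : ℕ) : ZMod (2 * n))) (by simp),
    card_carrier_a_of_eq_neg (neg_natCast_self n).symm,
    Finset.prod_congr rfl fun i hi => by
      rw [card_carrier_a_of_ne_neg (natCast_ne_neg_natCast hi)]]
  · simp
    ring
  · simpa using fun i _ => (hax i 1).symm
  · rw [Finset.mem_insert, not_or]
    exact ⟨xa_zero_mk_ne, by simpa using fun i _ => (hax i 0).symm⟩

/-- Every commutator of two elements is some `a (2 * j)`, and `a 2` is itself the commutator of `a
1` and `xa 0`. -/
theorem commutator_eq_zpowers :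
    commutator (QuaternionGroup n) = Subgroup.zpowers (a 2) := by
  have hmem : ∀ j : ZMod (2 * n), a (2 * j) ∈ Subgroup.zpowers (a 2 : QuaternionGroup n) := by
    intro j
    refine ⟨j.val, ?_⟩
    have h2 : (a 2 : QuaternionGroup n) = a 1 ^ 2 := by simp
    simp only [zpow_natCast]
    rw [h2, ← pow_mul, a_one_pow]
    simp
  have hinv : ∀ i : ZMod (2 * n), (a i : QuaternionGroup n)⁻¹ = a (-i) := fun _ => rfl
  have hxinv : ∀ i : ZMod (2 * n), (xa i : QuaternionGroup n)⁻¹ = xa ((n : ZMod (2 * n)) + i) := fun _ => rfl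
  apply le_antisymm
  · rw [commutator_def, Subgroup.commutator_le]
    rintro (i | i) - (j | j) - <;>
      rw [commutatorElement_def] <;>
      simp only [hinv, hxinv, a_mul_a, a_mul_xa, xa_mul_a, xa_mul_xa]
    · convert hmem 0 using 2
      ring
    · convert hmem i using 2
      linear_combination -neg_natCast_self n
    · convert hmem (-j) using 2
      linear_combination -neg_natCast_self n
    · convert hmem (j - i) using 2
      linear_combination -neg_natCast_self n
  · rw [Subgroup.zpowers_le]
    have h : (a 2 : QuaternionGroup n) = a 1 * xa 0 * (a 1)⁻¹ * (xa 0)⁻¹ := by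
      rw [hinv, hxinv, a_mul_xa, xa_mul_a, xa_mul_xa]
      congr 1
      have := neg_natCast_self n
      grind
    rw [h]
    exact Subgroup.commutator_mem_commutator (Subgroup.mem_top _) (Subgroup.mem_top _)

theorem card_commutator : Nat.card (commutator (QuaternionGroup n)) = n := by
  have h2 : (a 2 : QuaternionGroup n) = a 1 ^ 2 := by simp
  rw [commutator_eq_zpowers, Nat.card_zpowers, h2, orderOf_pow_of_dvd two_ne_zero (by simp),
    orderOf_a_one, Nat.mul_div_cancel_left n two_pos]

end QuaternionGroup

theorem mainTheorem9 (n : ℕ) [NeZero n] (hn : 2 ≤ n) :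
    haradaNumber (QuaternionGroup n) = (n : ℂ) ^ 2 ∧
      haradaNumber (QuaternionGroup n) =
        (Nat.card (commutator (QuaternionGroup n)) : ℂ) ^ 2 := by
  have h : haradaNumber (QuaternionGroup n) = (n : ℂ) ^ 2 := by
    rw [haradaNumber, QuaternionGroup.prod_card_conjClasses, QuaternionGroup.prod_irrChars_one,
      mul_div_cancel_left₀ _ (pow_ne_zero _ two_ne_zero)]
  exact ⟨h, by rw [h, QuaternionGroup.card_commutator]⟩
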